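/- **Setting.** Let $M_y,M_u,D\in\mathbb N$, $M=M_y+M_u+1$, and let $\phi:\mathbb R^{M}\to\mathbb R^{D}$ be a feature map (for instance a polynomial basis expansion). Let $\hat y_i,\hat u_i\in\mathbb R$ be the observed outputs and controls; $\mathcal D_k=\{(\hat y_i,\hat u_i)\}_{i=1}^k$ is the data up to time $k$, and values at times $i\le 0$ serve as initial conditions. Put $\hat x_i=(\hat y_{i-1},\dots,\hat y_{i-M_y},\hat u_{i-1},\dots,\hat u_{i-M_u})$ and $\phi_i=\phi(\hat x_i,\hat u_i)$. Outputs have the likelihood $p(y_i\mid\theta,\tau,u_i)=\mathcal N(y_i\mid\theta^{\top}\phi(\hat x_i,u_i),\tau^{-1})$ with unknown $\theta\in\mathbb R^D$, $\tau>0$, and the prior is $p(\theta,\tau)=\mathcal N(\theta\mid\mu_0,(\tau\Lambda_0)^{-1})\,\mathcal G(\tau\mid\alpha_0,\beta_0)$ (shape $\alpha_0$, rate $\beta_0$), where $\Lambda_0$ is symmetric positive definite and $\alpha_0,\beta_0>0$. The posterior is given by Bayesian filtering: $p(\theta,\tau\mid\mathcal D_0)=p(\theta,\tau)$ and $$p(\theta,\tau\mid\mathcal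 D_i)=\frac{p(\hat y_i\mid\theta,\tau,\hat u_i)\,p(\theta,\tau\mid\mathcal D_{i-1})}{\int p(\hat y_i\mid\theta,\tau,\hat u_i)\,p(\theta,\tau\mid\mathcal D_{i-1})\,\mathrm d(\theta,\tau)} .$$ Define recursively $$\Lambda_i=\phi_i\phi_i^{\top}+\Lambda_{i-1},\quad \mu_i=\Lambda_i^{-1}(\phi_i\hat y_i+\Lambda_{i-1}\mu_{i-1}),\quad \alpha_i=\alpha_{i-1}+\tfrac12,\quad \beta_i=\beta_{i-1}+\tfrac12\big(\hat y_i^2-\mu_i^{\top}\Lambda_i\mu_i+\mu_{i-1}^{\top}\Lambda_{i-1}\mu_{i-1}\big).$$ Fix $k\ge 0$, let $t=k+1$, and for $u_t\in\mathbb R$ let $\phi_t=\phi(\hat x_t,u_t)$, $p(y_t,\theta,\tau\mid u_t)=p(y_t\mid\theta,\tau,u_t)\,p(\theta,\tau\mid\mathcal D_k)$, $p(y_t\mid u_t)=\int p(y_t,\theta,\tau\mid u_t)\,\mathrm d(\theta,\tau)$ and $p(\theta,\tau\mid y_t,u_t)=p(y_t,\theta,\tau\mid u_t)/p(y_t\mid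 u_t)$. Given a Gaussian goal prior $p(y_t\mid y_*)=\mathcal N(y_t\mid m_*,v_*)$ with $m_*\in\mathbb R$, $v_*>0$, the expected free energy function is $$\mathcal J(u_t)=\mathbb E_{p(y_t,\theta,\tau\mid u_t)}\Big[\ln\frac{p(\theta,\tau\mid\mathcal D_k)}{p(\theta,\tau\mid y_t,u_t)\,p(y_t\mid y_*)}\Big].$$ **Theorem.** Assume $\alpha_k>1$. Then there is a constant $C\in\mathbb R$, independent of $u_t$, such that for every $u_t\in\mathbb R$ all the expectations below exist (the integrands are absolutely integrable), as does the one defining $\mathcal J(u_t)$; the function $\mathcal J$ is cross-entropy minus mutual information, $$\mathcal J(u_t)=\mathbb E_{p(y_t\mid u_t)}\big[-\ln p(y_t\mid y_*)\big]-\mathbb E_{p(y_t,\theta,\tau\mid u_t)}\Big[\ln\frac{p(y_t,\theta,\tau\mid u_t)}{p(\theta,\tau\mid\mathcal D_k)\,p(y_t\mid u_t)}\Big];$$ and $$\mathcal J(u_t)=\frac1{2v_*}\Big((\mu_k^{\top}\phi_t-m_*)^2+\frac{\beta_k}{\alpha_k}\big(\phi_t^{\top}\Lambda_k^{-1}\phi_t+1\big)\frac{2\alpha_k}{2\alpha_k-2}\Big)-\frac12\ln\big(\phi_t^{\top}\Lambda_k^{-1}\phi_t+1\big)+C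 .$$ -/

import Mathlib

open MeasureTheory ProbabilityTheory Matrix

noncomputable section

namespace NARX

/-- Density at `y` of the univariate normal distribution with mean `m` and variance `v > 0`. -/
def normalPDF (m v y : ℝ) : ℝ := gaussianPDFReal m v.toNNReal y

/-- Density at `θ` (with respect to Lebesgue measure on `ℝ^D`) of the multivariate normal
distribution with mean `μ` and covariance matrix `S`. -/
def mvNormalPDF {D : ℕ} (μ : Fin D → ℝ) (S : Matrix (Fin D) (Fin D) ℝ) (θ : Fin D → ℝ) : ℝ :=
  (Real.sqrt ((2 * Real.pi) ^ D * S.det))⁻¹ *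
    Real.exp (-(1 / 2) * ((θ - μ) ⬝ᵥ (S⁻¹ *ᵥ (θ - μ))))

/-- Parameters of a multivariate normal - univariate gamma distribution on `ℝ^D × ℝ⁺`:
mean `μ`, precision matrix `Λ`, shape `α`, rate `β`. -/
structure NGParam (D : ℕ) where
  μ : Fin D → ℝ
  Λ : Matrix (Fin D) (Fin D) ℝ
  α : ℝ
  β : ℝ

/-- Normal-gamma density `N(θ | μ, (τ Λ)⁻¹) · G(τ | α, β)`; it vanishes for `τ < 0`. -/
def NGParam.pdf {D : ℕ} (q : NGParam D) (θ : Fin D → ℝ) (τ : ℝ) : ℝ :=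
  mvNormalPDF q.μ (τ • q.Λ)⁻¹ θ * gammaPDFReal q.α q.β τ

/-- The update of the normal-gamma parameters after the output `y` has been observed for the
regressor `f`. -/
def NGParam.update {D : ℕ} (q : NGParam D) (f : Fin D → ℝ) (y : ℝ) : NGParam D :=
  let Λ' : Matrix (Fin D) (Fin D) ℝ := vecMulVec f f + q.Λ
  let μ' : Fin D → ℝ := Λ'⁻¹ *ᵥ (y • f + q.Λ *ᵥ q.μ)
  { μ := μ'
    Λ := Λ'
    α := q.α + 1 / 2
    β := q.β + 1 / 2 * (y ^ 2 - μ' ⬝ᵥ (Λ' *ᵥ μ') + q.μ ⬝ᵥ (q.Λ *ᵥ q.μ)) }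

/-- A NARX agent: the basis expansion `φ` of `M_y` past outputs, `M_u` past controls and the current
control, the parameters of the normal-gamma prior, and the observed outputs and controls.
The data are those at times `1, 2, …`; values at times `≤ 0` only serve as initial conditions
in the delay vectors. -/
structure Agent (My Mu D : ℕ) where
  φ : (Fin (My + Mu + 1) → ℝ) → (Fin D → ℝ)
  prior : NGParam D
  yObs : ℤ → ℝ
  uObs : ℤ → ℝ

namespace Agent

variable {My Mu D : ℕ} (A : Agent My Mu D)

/-- The delay vector `x_t = (y_{t-1}, …, y_{t-M_y}, u_{t-1}, …, u_{t-M_u})` of observed values. -/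
def delay (t : ℤ) : Fin (My + Mu) → ℝ :=
  Fin.append (fun i : Fin My => A.yObs (t - 1 - (i : ℕ)))
    (fun j : Fin Mu => A.uObs (t - 1 - (j : ℕ)))

/-- The regressor `φ(x_t, u)`. -/
def feature (t : ℤ) (u : ℝ) : Fin D → ℝ :=
  A.φ (Fin.snoc (α := fun _ => ℝ) (A.delay t) u)

/-- The likelihood `p(y | θ, τ, u) = N(y | θᵀ φ(x_t, u), τ⁻¹)` at time `t`. -/
def likelihood (t : ℤ) (u y : ℝ) (θ : Fin D → ℝ) (τ : ℝ) : ℝ :=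
  normalPDF (θ ⬝ᵥ A.feature t u) τ⁻¹ y

/-- The parameter posterior `p(θ, τ | D_k)`, by Bayesian filtering from the normal-gamma prior:
likelihood times previous posterior, divided by the evidence. -/
def posterior : ℕ → (Fin D → ℝ) → ℝ → ℝ
  | 0 => A.prior.pdf
  | k + 1 => fun θ τ =>
      A.likelihood (k + 1) (A.uObs (k + 1)) (A.yObs (k + 1)) θ τ * posterior k θ τ /
        ∫ w : (Fin D → ℝ) × ℝ,
          A.likelihood (k + 1) (A.uObs (k + 1)) (A.yObs (k + 1)) w.1 w.2 * posterior k w.1 w.2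

/-- The parameters `(μ_k, Λ_k, α_k, β_k)` given by the recursive update rules. -/
def param : ℕ → NGParam D
  | 0 => A.prior
  | k + 1 => (param k).update (A.feature (k + 1) (A.uObs (k + 1))) (A.yObs (k + 1))

/-! In what follows `t = k + 1` is the next time step and `u` is the control `u_t`. -/

/-- The joint density `p(y_t, θ, τ | u_t) = p(y_t | θ, τ, u_t) p(θ, τ | D_k)`. -/
def joint (k : ℕ) (u y : ℝ) (θ : Fin D → ℝ) (τ : ℝ) : ℝ :=
  A.likelihood (k + 1) u y θ τ * A.posterior k θ τ

/-- The posterior predictive density `p(y_t | u_t)`. -/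
def predictive (k : ℕ) (u y : ℝ) : ℝ :=
  ∫ w : (Fin D → ℝ) × ℝ, A.joint k u y w.1 w.2

/-- The parameter density `p(θ, τ | y_t, u_t)` given a future output, by Bayes' rule. -/
def futurePosterior (k : ℕ) (u y : ℝ) (θ : Fin D → ℝ) (τ : ℝ) : ℝ :=
  A.joint k u y θ τ / A.predictive k u y

/-- Integrand of `E_{p(y_t, θ, τ | u_t)} [ln (p(θ, τ | D_k) / (p(θ, τ | y_t, u_t) p(y_t | y_*)))]`,
with goal prior `p(y_t | y_*) = N(y_t | m, v)`. -/
def efeIntegrand (k : ℕ) (m v u : ℝ) (z : ℝ × (Fin D → ℝ) × ℝ) : ℝ :=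
  A.joint k u z.1 z.2.1 z.2.2 *
    Real.log (A.posterior k z.2.1 z.2.2 /
      (A.futurePosterior k u z.1 z.2.1 z.2.2 * normalPDF m v z.1))

/-- The expected free energy function `J(u_t)`. -/
def efe (k : ℕ) (m v u : ℝ) : ℝ :=
  ∫ z : ℝ × (Fin D → ℝ) × ℝ, A.efeIntegrand k m v u z

/-- Integrand of `E_{p(y_t | u_t)} [-ln p(y_t | y_*)]`. -/
def crossEntropyIntegrand (k : ℕ) (m v u y : ℝ) : ℝ :=
  A.predictive k u y * -Real.log (normalPDF m v y)

/-- The cross-entropy of the goal prior relative to the posterior predictive distribution. -/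
def crossEntropy (k : ℕ) (m v u : ℝ) : ℝ :=
  ∫ y : ℝ, A.crossEntropyIntegrand k m v u y

/-- Integrand of
`E_{p(y_t, θ, τ | u_t)} [ln (p(y_t, θ, τ | u_t) / (p(θ, τ | D_k) p(y_t | u_t)))]`. -/
def mutualInfoIntegrand (k : ℕ) (u : ℝ) (z : ℝ × (Fin D → ℝ) × ℝ) : ℝ :=
  A.joint k u z.1 z.2.1 z.2.2 *
    Real.log (A.joint k u z.1 z.2.1 z.2.2 /
      (A.posterior k z.2.1 z.2.2 * A.predictive k u z.1))

/-- The mutual information between the parameters `(θ, τ)` and the predicted output `y_t`. -/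
def mutualInfo (k : ℕ) (u : ℝ) : ℝ :=
  ∫ z : ℝ × (Fin D → ℝ) × ℝ, A.mutualInfoIntegrand k u z

end Agent

end NARX

end

/-! Multiplying the normal-gamma density by the Gaussian likelihood and completing the square
gives a density in `y` times a normal-gamma density with updated parameters. So filtering stays
within the normal-gamma family, with the parameters given by the recursion, and the predictive
density is a Student density whose shape does not depend on the control, with location `μᵀ φ_t`
and scale `√(φ_tᵀ Λ⁻¹ φ_t + 1)`.

Bayes' rule splits the logarithm in `J` pointwise into a cross-entropy and a mutual information
term. The cross-entropy with respect to a Gaussian goal is a second moment of the predictive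
density. The mutual information is the entropy of the output minus its conditional entropy given
`(θ, τ)`. The latter depends on the precision `τ` only, not on the control, while rescaling the
Student density adds the logarithm of the scale to its entropy. -/

noncomputable section

namespace NARX

section Density

variable {X Y : Type*} [MeasurableSpace X] [MeasurableSpace Y] {μ : Measure X} {ν : Measure Y}

/-- `f` is integrable with integral `I`: the integral analogue of `HasSum`, which rules out the
value `0` that Mathlib assigns to the integral of a non-integrable function. -/
structure HasIntegral (f : X → ℝ) (I : ℝ) (μ : Measure X := by volume_tac) : Prop where
  integrable : Integrable f μ
  integral_eq : ∫ x, f x ∂μ = I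

/-- `f` is a probability density with respect to `μ`. -/
structure IsProbDensity (f : X → ℝ) (μ : Measure X := by volume_tac) : Prop where
  nonneg : ∀ x, 0 ≤ f x
  hasIntegral : HasIntegral f 1 μ

namespace HasIntegral

variable {f g : X → ℝ} {I J : ℝ}

theorem congr (hf : HasIntegral f I μ) (h : f =ᵐ[μ] g) : HasIntegral g I μ :=
  ⟨hf.integrable.congr h, (integral_congr_ae h).symm.trans hf.integral_eq⟩

theorem add (hf : HasIntegral f I μ) (hg : HasIntegral g J μ) :
    HasIntegral (fun x => f x + g x) (I + J) μ :=
  ⟨hf.integrable.add hg.integrable, by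
    rw [integral_add hf.integrable hg.integrable, hf.integral_eq, hg.integral_eq]⟩

theorem sub (hf : HasIntegral f I μ) (hg : HasIntegral g J μ) :
    HasIntegral (fun x => f x - g x) (I - J) μ :=
  ⟨hf.integrable.sub hg.integrable, by
    rw [integral_sub hf.integrable hg.integrable, hf.integral_eq, hg.integral_eq]⟩

theorem const_mul (hf : HasIntegral f I μ) (c : ℝ) : HasIntegral (fun x => c * f x) (c * I) μ :=
  ⟨hf.integrable.const_mul c, by rw [integral_const_mul, hf.integral_eq]⟩

theorem mul_condDensity [SFinite μ] [SFinite ν] {K : X → Y → ℝ} (hg : HasIntegral g I μ)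
    (hmeas : AEStronglyMeasurable (fun z : X × Y => g z.1 * K z.1 z.2) (μ.prod ν))
    (hK : ∀ᵐ x ∂μ, g x ≠ 0 → IsProbDensity (K x) ν) :
    HasIntegral (fun z : X × Y => g z.1 * K z.1 z.2) I (μ.prod ν) := by
  have section_hasIntegral : ∀ᵐ x ∂μ, HasIntegral (fun y => g x * K x y) (g x) ν := by
    filter_upwards [hK] with x hx
    rcases eq_or_ne (g x) 0 with h0 | h0
    · simpa only [h0, zero_mul] using ⟨integrable_zero Y ℝ ν, integral_zero Y ℝ⟩
    · simpa only [mul_one] using (hx h0).hasIntegral.const_mul (g x)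
  have norm_section : ∀ᵐ x ∂μ, ∫ y, ‖g x * K x y‖ ∂ν = ‖g x‖ := by
    filter_upwards [hK] with x hx
    rcases eq_or_ne (g x) 0 with h0 | h0
    · simp only [h0, zero_mul, norm_zero, integral_zero]
    · simp only [norm_mul, Real.norm_of_nonneg ((hx h0).nonneg _), integral_const_mul,
        (hx h0).hasIntegral.integral_eq, mul_one]
  have hint : Integrable (fun z : X × Y => g z.1 * K z.1 z.2) (μ.prod ν) :=
    (integrable_prod_iff hmeas).mpr ⟨section_hasIntegral.mono fun _ h => h.integrable,
      hg.integrable.norm.congr (norm_section.mono fun _ h => h.symm)⟩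
  refine ⟨hint, ?_⟩
  rw [integral_prod _ hint, ← hg.integral_eq]
  exact integral_congr_ae (section_hasIntegral.mono fun _ h => h.integral_eq)

theorem mul_condDensity_swap [SFinite μ] [SFinite ν] {g : Y → ℝ} {K : Y → X → ℝ}
    (hg : HasIntegral g I ν)
    (hmeas : AEStronglyMeasurable (fun z : X × Y => g z.2 * K z.2 z.1) (μ.prod ν))
    (hK : ∀ᵐ y ∂ν, g y ≠ 0 → IsProbDensity (K y) μ) :
    HasIntegral (fun z : X × Y => g z.2 * K z.2 z.1) I (μ.prod ν) := by
  have h := hg.mul_condDensity hmeas.prod_swap hK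
  exact ⟨integrable_swap_iff.mp h.integrable, by
    rw [← h.integral_eq, ← integral_prod_swap]; rfl⟩

end HasIntegral

namespace IsProbDensity

variable {f g : X → ℝ}

theorem integrable (hf : IsProbDensity f μ) : Integrable f μ := hf.hasIntegral.integrable

theorem of_integral_eq_one (hf : ∀ x, 0 ≤ f x) (h : ∫ x, f x ∂μ = 1) : IsProbDensity f μ :=
  ⟨hf, .of_integral_ne_zero (by rw [h]; exact one_ne_zero), h⟩

end IsProbDensity

end Density

section LocationScale

/-- The density of `m + σ Y` when `g` is the density of `Y`. -/
def locScale (g : ℝ → ℝ) (m σ y : ℝ) : ℝ := σ⁻¹ * g ((y - m) / σ)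

/-- The differential entropy of the density `f`. -/
def diffEntropy (f : ℝ → ℝ) : ℝ := ∫ y, Real.negMulLog (f y)

variable {g : ℝ → ℝ} {m σ I : ℝ}

protected theorem HasIntegral.locScale (hg : HasIntegral g I) (m : ℝ) (hσ : 0 < σ) :
    HasIntegral (locScale g m σ) I := by
  refine ⟨((hg.integrable.comp_div hσ.ne').comp_sub_right m).const_mul σ⁻¹, ?_⟩
  simp only [locScale]
  rw [integral_const_mul, integral_sub_right_eq_self (fun y => g (y / σ)),
    Measure.integral_comp_div, abs_of_pos hσ, smul_eq_mul, inv_mul_cancel_left₀ hσ.ne',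
    hg.integral_eq]

protected theorem IsProbDensity.locScale (hg : IsProbDensity g) (m : ℝ) (hσ : 0 < σ) :
    IsProbDensity (locScale g m σ) :=
  ⟨fun _ => mul_nonneg (inv_nonneg.mpr hσ.le) (hg.nonneg _), hg.hasIntegral.locScale m hσ⟩

theorem IsProbDensity.hasIntegral_locScale_mul_sq_sub {V : ℝ} (hg : IsProbDensity g)
    (hmean : HasIntegral (fun x => g x * x) 0) (hvar : HasIntegral (fun x => g x * x ^ 2) V)
    (m b : ℝ) (hσ : 0 < σ) :
    HasIntegral (fun y => locScale g m σ y * (y - b) ^ 2) ((m - b) ^ 2 + σ ^ 2 * V) := by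
  have hstd : HasIntegral (fun x => g x * (m + σ * x - b) ^ 2) ((m - b) ^ 2 + σ ^ 2 * V) := by
    have h := ((hg.hasIntegral.const_mul ((m - b) ^ 2)).add
      (hmean.const_mul (2 * σ * (m - b)))).add (hvar.const_mul (σ ^ 2))
    simp only [mul_one, mul_zero, add_zero] at h
    exact h.congr (.of_forall fun x => by ring)
  refine (hstd.locScale m hσ).congr (.of_forall fun y => ?_)
  simp only [locScale, mul_div_cancel₀ _ hσ.ne', add_sub_cancel, mul_assoc]

theorem IsProbDensity.hasIntegral_negMulLog_locScale (hg : IsProbDensity g)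
    (hent : Integrable fun x => Real.negMulLog (g x)) (m : ℝ) (hσ : 0 < σ) :
    HasIntegral (fun y => Real.negMulLog (locScale g m σ y))
      (diffEntropy g + Real.log σ) := by
  have h := ((⟨hent, rfl⟩ : HasIntegral (fun x => Real.negMulLog (g x)) (diffEntropy g)).add
    (hg.hasIntegral.const_mul (Real.log σ))).locScale m hσ
  rw [mul_one] at h
  refine h.congr (.of_forall fun y => ?_)
  simp only [locScale]
  rw [Real.negMulLog_mul]
  simp only [Real.negMulLog, Real.log_inv]
  ring

end LocationScale

section RankOneUpdate

variable {n R K : Type*} [Fintype n] [CommRing R] [Field K]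

theorem dotProduct_mulVec_comm_of_isSymm {L : Matrix n n R} (hL : L.IsSymm) (x y : n → R) :
    x ⬝ᵥ (L *ᵥ y) = y ⬝ᵥ (L *ᵥ x) := by
  rw [dotProduct_mulVec, ← mulVec_transpose, hL.eq, dotProduct_comm]

variable [DecidableEq n] {L : Matrix n n R} {P : Matrix n n K}

theorem mulVec_inv_mulVec (hL : IsUnit L.det) (x : n → R) : L *ᵥ (L⁻¹ *ᵥ x) = x := by
  rw [mulVec_mulVec, mul_nonsing_inv _ hL, one_mulVec]

theorem det_vecMulVec_self_add (hL : IsUnit L.det) (f : n → R) :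
    (vecMulVec f f + L).det = L.det * (f ⬝ᵥ (L⁻¹ *ᵥ f) + 1) := by
  rw [add_comm, vecMulVec_eq Unit, det_add_replicateCol_mul_replicateRow hL,
    det_unique (n := Unit), Matrix.add_apply, one_apply_eq, Matrix.mul_assoc,
    ← replicateCol_mulVec, replicateRow_mul_replicateCol_apply, add_comm]

theorem vecMulVec_self_add_mulVec (hL : IsUnit L.det) (μ f : n → R) (c : R) :
    (vecMulVec f f + L) *ᵥ (μ + c • (L⁻¹ *ᵥ f)) =
      (μ ⬝ᵥ f + c * (f ⬝ᵥ (L⁻¹ *ᵥ f) + 1)) • f + L *ᵥ μ := by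
  rw [add_mulVec, vecMulVec_mulVec, mulVec_add L, mulVec_smul, mulVec_inv_mulVec hL,
    dotProduct_add, dotProduct_smul, dotProduct_comm f μ, smul_eq_mul, op_smul_eq_smul]
  module

theorem matrix_inv_smul (c : K) (P : Matrix n n K) : (c • P)⁻¹ = c⁻¹ • P⁻¹ := by
  rcases eq_or_ne c 0 with rfl | hc
  · rw [zero_smul, Matrix.inv_zero, _root_.inv_zero, zero_smul]
  by_cases hP : IsUnit P.det
  · exact inv_smul' P (Units.mk0 c hc) hP
  · have hcP : ¬IsUnit (c • P).det := by
      rwa [det_smul, IsUnit.mul_iff, and_iff_right ((isUnit_iff_ne_zero.mpr hc).pow _)]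
    rw [nonsing_inv_apply_not_isUnit _ hP, nonsing_inv_apply_not_isUnit _ hcP, smul_zero]

theorem inv_vecMulVec_self_add_mulVec (hP : IsUnit P.det) {f : n → K}
    (hf : f ⬝ᵥ (P⁻¹ *ᵥ f) + 1 ≠ 0) (μ : n → K) (y : K) :
    (vecMulVec f f + P)⁻¹ *ᵥ (y • f + P *ᵥ μ) =
      μ + ((y - μ ⬝ᵥ f) / (f ⬝ᵥ (P⁻¹ *ᵥ f) + 1)) • (P⁻¹ *ᵥ f) := by
  have hdet : IsUnit (vecMulVec f f + P).det := by
    rw [det_vecMulVec_self_add hP]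
    exact hP.mul (isUnit_iff_ne_zero.mpr hf)
  have hmul := vecMulVec_self_add_mulVec hP μ f ((y - μ ⬝ᵥ f) / (f ⬝ᵥ (P⁻¹ *ᵥ f) + 1))
  rw [div_mul_cancel₀ _ hf, add_sub_cancel] at hmul
  rw [← hmul, mulVec_mulVec, nonsing_inv_mul _ hdet, one_mulVec]

theorem sq_sub_add_quadForm_eq (hsymm : P.IsSymm) (hP : IsUnit P.det) {f : n → K}
    (hf : f ⬝ᵥ (P⁻¹ *ᵥ f) + 1 ≠ 0) (μ θ : n → K) (y : K) :
    let P' := vecMulVec f f + P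
    let μ' := P'⁻¹ *ᵥ (y • f + P *ᵥ μ)
    (y - θ ⬝ᵥ f) ^ 2 + (θ - μ) ⬝ᵥ (P *ᵥ (θ - μ)) =
      (y - μ ⬝ᵥ f) ^ 2 / (f ⬝ᵥ (P⁻¹ *ᵥ f) + 1) + (θ - μ') ⬝ᵥ (P' *ᵥ (θ - μ')) := by
  intro P' μ'
  set s := f ⬝ᵥ (P⁻¹ *ᵥ f) + 1 with hs
  obtain ⟨c, hc⟩ : ∃ c, y = μ ⬝ᵥ f + c * s := ⟨(y - μ ⬝ᵥ f) / s, by field_simp; ring⟩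
  have hμ' : μ' = μ + c • (P⁻¹ *ᵥ f) := by
    simp only [μ', P', inv_vecMulVec_self_add_mulVec hP hf, ← hs, hc, add_sub_cancel_left,
      mul_div_cancel_right₀ _ hf]
  obtain ⟨d, rfl⟩ : ∃ d, θ = μ + d := ⟨θ - μ, by abel⟩
  have hdev : P' *ᵥ (d + (-c) • (P⁻¹ *ᵥ f)) = (d ⬝ᵥ f - c * s) • f + P *ᵥ d := by
    simp only [P', vecMulVec_self_add_mulVec hP, ← hs]
    ring_nf
  have hcross : (P⁻¹ *ᵥ f) ⬝ᵥ (P *ᵥ d) = d ⬝ᵥ f := by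
    rw [dotProduct_mulVec_comm_of_isSymm hsymm, mulVec_inv_mulVec hP]
  have hself : (P⁻¹ *ᵥ f) ⬝ᵥ f = s - 1 := by rw [dotProduct_comm, hs, add_sub_cancel_right]
  rw [show μ + d - μ' = d + (-c) • (P⁻¹ *ᵥ f) by rw [hμ']; module, hdev, add_sub_cancel_left, hc,
    add_sub_cancel_left]
  simp only [add_dotProduct, dotProduct_add, smul_dotProduct, dotProduct_smul, smul_eq_mul,
    hcross, hself]
  field_simp
  ring

theorem quadForm_inv_add_one_pos {P : Matrix n n ℝ} (hP : P.PosDef) (f : n → ℝ) :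
    0 < f ⬝ᵥ (P⁻¹ *ᵥ f) + 1 :=
  add_pos_of_nonneg_of_pos (hP.inv.posSemidef.dotProduct_mulVec_nonneg f) one_pos

end RankOneUpdate

section Normal

variable {v : ℝ}

theorem normalPDF_eq (hv : 0 < v) (m y : ℝ) :
    normalPDF m v y = (√(2 * Real.pi * v))⁻¹ * Real.exp (-(y - m) ^ 2 / (2 * v)) := by
  simp only [normalPDF, gaussianPDFReal, Real.coe_toNNReal v hv.le]

theorem isProbDensity_normalPDF (hv : 0 < v) (m : ℝ) : IsProbDensity (normalPDF m v) :=
  .of_integral_eq_one (gaussianPDFReal_nonneg m v.toNNReal)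
    (integral_gaussianPDFReal_eq_one m (Real.toNNReal_pos.mpr hv).ne')

theorem measurable_normalPDF {X : Type*} [MeasurableSpace X] {m v y : X → ℝ} (hm : Measurable m)
    (hv : Measurable v) (hy : Measurable y) : Measurable fun x => normalPDF (m x) (v x) (y x) :=
  measurable_uncurry_gaussianPDFReal.comp (hm.prodMk (hv.real_toNNReal.prodMk hy))

theorem isProbDensity_normalPDF_mul_sq (hv : 0 < v) (m : ℝ) :
    IsProbDensity fun y => normalPDF m v y * ((y - m) ^ 2 / v) := by
  have hvar : ∫ y, normalPDF m v y * (y - m) ^ 2 = v := by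
    have h := variance_fun_id_gaussianReal (μ := m) (v := v.toNNReal)
    rwa [variance_eq_integral measurable_id'.aemeasurable, integral_id_gaussianReal,
      integral_gaussianReal_eq_integral_smul (Real.toNNReal_pos.mpr hv).ne',
      Real.coe_toNNReal _ hv.le] at h
  refine .of_integral_eq_one (fun y => ?_) ?_
  · exact mul_nonneg (gaussianPDFReal_nonneg _ _ _) (by positivity)
  · simp only [← mul_div_assoc]
    rw [integral_div, hvar, div_self hv.ne']

theorem log_normalPDF (hv : 0 < v) (m y : ℝ) :
    Real.log (normalPDF m v y) =
      -(1 / 2) * Real.log (2 * Real.pi * v) - (y - m) ^ 2 / v / 2 := by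
  rw [normalPDF_eq hv, Real.log_mul (by positivity) (by positivity), Real.log_inv,
    Real.log_sqrt (by positivity), Real.log_exp]
  ring

theorem diffEntropy_normalPDF (hv : 0 < v) (m : ℝ) :
    diffEntropy (normalPDF m v) = 1 / 2 * Real.log (2 * Real.pi * v) + 1 / 2 := by
  have h := ((isProbDensity_normalPDF hv m).hasIntegral.const_mul
    (1 / 2 * Real.log (2 * Real.pi * v))).add
      ((isProbDensity_normalPDF_mul_sq hv m).hasIntegral.const_mul (1 / 2))
  rw [mul_one, mul_one] at h
  refine (h.congr (.of_forall fun y => ?_)).integral_eq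
  simp only [Real.negMulLog, log_normalPDF hv]
  ring

theorem normalPDF_sq_mul {σ : ℝ} (hσ : 0 < σ) (hv : 0 < v) (m : ℝ) :
    normalPDF m (σ ^ 2 * v) = locScale (normalPDF 0 v) m σ := by
  ext y
  rw [locScale, normalPDF_eq (by positivity), normalPDF_eq hv,
    show 2 * Real.pi * (σ ^ 2 * v) = σ ^ 2 * (2 * Real.pi * v) by ring,
    Real.sqrt_mul (sq_nonneg σ), Real.sqrt_sq hσ.le, mul_inv, mul_assoc]
  congr 3
  field_simp
  ring

end Normal

section MultivariateNormal

variable {ι E : Type*} [Fintype ι] [NormedAddCommGroup E] [NormedSpace ℝ E] {D : ℕ}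

theorem integral_exp_neg_half_dotProduct_self :
    ∫ x : ι → ℝ, Real.exp (-(1 / 2) * (x ⬝ᵥ x)) = √((2 * Real.pi) ^ Fintype.card ι) := by
  have hprod (x : ι → ℝ) :
      Real.exp (-(1 / 2) * (x ⬝ᵥ x)) = ∏ i, Real.exp (-(1 / 2) * x i ^ 2) := by
    rw [← Real.exp_sum, dotProduct, Finset.mul_sum]
    simp only [sq]
  simp only [hprod]
  rw [integral_fintype_prod_volume_eq_pow (fun x : ℝ => Real.exp (-(1 / 2) * x ^ 2)),
    integral_gaussian, div_div_eq_mul_div, div_one, mul_comm Real.pi, eq_comm,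
    Real.sqrt_eq_iff_eq_sq (by positivity) (by positivity), ← pow_mul', pow_mul,
    Real.sq_sqrt (by positivity)]

variable [DecidableEq ι]

theorem integral_comp_mulVec {B : Matrix ι ι ℝ} (hB : B.det ≠ 0) (F : (ι → ℝ) → E) :
    ∫ x, F (B *ᵥ x) = |B.det|⁻¹ • ∫ x, F x := by
  have hunit : IsUnit B := (isUnit_iff_isUnit_det B).mpr hB.isUnit
  have hrange : Set.range (toLin' B) = Set.univ :=
    (mulVec_surjective_iff_isUnit.mpr hunit).range_eq
  have h := integral_image_eq_integral_abs_det_fderiv_smul volume MeasurableSet.univ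
    (fun x _ => (LinearMap.toContinuousLinearMap (toLin' B)).hasFDerivWithinAt (x := x))
    (mulVec_injective_iff_isUnit.mpr hunit).injOn F
  simp only [LinearMap.coe_toContinuousLinearMap', toLin'_apply, Set.image_univ, hrange,
    Measure.restrict_univ, ContinuousLinearMap.det, LinearMap.coe_toContinuousLinearMap,
    LinearMap.det_toLin', integral_smul] at h
  rw [h, smul_smul, inv_mul_cancel₀ (abs_ne_zero.mpr hB), one_smul]

open scoped MatrixOrder in
theorem integral_exp_neg_half_quadForm {P : Matrix ι ι ℝ} (hP : P.PosDef) :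
    ∫ x, Real.exp (-(1 / 2) * (x ⬝ᵥ (P *ᵥ x))) =
      √((2 * Real.pi) ^ Fintype.card ι * P.det⁻¹) := by
  obtain ⟨B, hB⟩ := (CStarAlgebra.nonneg_iff_eq_star_mul_self (a := P)).mp hP.posSemidef.nonneg
  rw [star_eq_conjTranspose, conjTranspose_eq_transpose_of_trivial] at hB
  have hdet : P.det = B.det ^ 2 := by rw [hB, det_mul, det_transpose, sq]
  have hB0 : B.det ≠ 0 := fun h => hP.det_pos.ne' (by rw [hdet, h, zero_pow two_ne_zero])
  have hquad (x : ι → ℝ) : x ⬝ᵥ (P *ᵥ x) = (B *ᵥ x) ⬝ᵥ (B *ᵥ x) := by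
    rw [hB, ← mulVec_mulVec, dotProduct_mulVec, vecMul_transpose]
  simp only [hquad]
  rw [integral_comp_mulVec hB0 fun x => Real.exp (-(1 / 2) * (x ⬝ᵥ x)),
    integral_exp_neg_half_dotProduct_self, hdet, Real.sqrt_mul (by positivity), ← inv_pow,
    Real.sqrt_sq_eq_abs, abs_inv, smul_eq_mul, mul_comm]

theorem mvNormalPDF_nonneg (μ : Fin D → ℝ) (S : Matrix (Fin D) (Fin D) ℝ) (θ : Fin D → ℝ) :
    0 ≤ mvNormalPDF μ S θ :=
  mul_nonneg (inv_nonneg.mpr (Real.sqrt_nonneg _)) (Real.exp_nonneg _)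

theorem isProbDensity_mvNormalPDF {S : Matrix (Fin D) (Fin D) ℝ} (hS : S.PosDef)
    (μ : Fin D → ℝ) : IsProbDensity (mvNormalPDF μ S) := by
  have hpos : 0 < √((2 * Real.pi) ^ D * S.det) := by
    have := hS.det_pos
    positivity
  refine .of_integral_eq_one (mvNormalPDF_nonneg μ S) ?_
  simp only [mvNormalPDF]
  rw [integral_const_mul,
    integral_sub_right_eq_self fun x => Real.exp (-(1 / 2) * (x ⬝ᵥ (S⁻¹ *ᵥ x))),
    integral_exp_neg_half_quadForm hS.inv, Fintype.card_fin, det_nonsing_inv,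
    Ring.inverse_eq_inv', inv_inv, inv_mul_cancel₀ hpos.ne']

theorem mvNormalPDF_inv_smul (μ : Fin D → ℝ) (P : Matrix (Fin D) (Fin D) ℝ) (τ : ℝ)
    (θ : Fin D → ℝ) :
    mvNormalPDF μ (τ • P)⁻¹ θ = (√((2 * Real.pi) ^ D * (τ ^ D * P.det)⁻¹))⁻¹ *
      Real.exp (-(1 / 2) * (τ * ((θ - μ) ⬝ᵥ (P⁻¹⁻¹ *ᵥ (θ - μ))))) := by
  simp only [mvNormalPDF, det_nonsing_inv, Ring.inverse_eq_inv', det_smul, Fintype.card_fin,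
    matrix_inv_smul, inv_inv, smul_mulVec, dotProduct_smul, smul_eq_mul, mul_inv, inv_pow]

theorem measurable_mvNormalPDF_inv_smul (μ : Fin D → ℝ) (P : Matrix (Fin D) (Fin D) ℝ) :
    Measurable fun w : (Fin D → ℝ) × ℝ => mvNormalPDF μ (w.2 • P)⁻¹ w.1 := by
  have hquad : Continuous fun θ : Fin D → ℝ => (θ - μ) ⬝ᵥ (P⁻¹⁻¹ *ᵥ (θ - μ)) := by fun_prop
  simp only [mvNormalPDF_inv_smul]
  exact (by fun_prop : Measurable fun w : (Fin D → ℝ) × ℝ => _).mul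
    ((measurable_snd.mul (hquad.measurable.comp measurable_fst)).const_mul _).exp

theorem normalPDF_mul_mvNormalPDF {P : Matrix (Fin D) (Fin D) ℝ} (hP : P.PosDef) {τ : ℝ}
    (hτ : 0 < τ) (μ f θ : Fin D → ℝ) (y : ℝ) :
    let P' := vecMulVec f f + P
    let μ' := P'⁻¹ *ᵥ (y • f + P *ᵥ μ)
    normalPDF (θ ⬝ᵥ f) τ⁻¹ y * mvNormalPDF μ (τ • P)⁻¹ θ =
      normalPDF (μ ⬝ᵥ f) ((f ⬝ᵥ (P⁻¹ *ᵥ f) + 1) * τ⁻¹) y * mvNormalPDF μ' (τ • P')⁻¹ θ := by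
  intro P' μ'
  have hs : 0 < f ⬝ᵥ (P⁻¹ *ᵥ f) + 1 := quadForm_inv_add_one_pos hP f
  have hdet := hP.det_pos
  have hunit : IsUnit P.det := hdet.ne'.isUnit
  have hdet' : P'.det = P.det * (f ⬝ᵥ (P⁻¹ *ᵥ f) + 1) := det_vecMulVec_self_add hunit f
  have hsquare := sq_sub_add_quadForm_eq (isHermitian_iff_isSymm.mp hP.isHermitian) hunit hs.ne'
    μ θ y
  have hconst : √(2 * Real.pi * τ⁻¹) * √((2 * Real.pi) ^ D * (τ ^ D * P.det)⁻¹) =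
      √(2 * Real.pi * ((f ⬝ᵥ (P⁻¹ *ᵥ f) + 1) * τ⁻¹)) *
        √((2 * Real.pi) ^ D * (τ ^ D * P'.det)⁻¹) := by
    rw [hdet', ← Real.sqrt_mul (by positivity), ← Real.sqrt_mul (by positivity)]
    congr 1
    field_simp
  rw [mvNormalPDF_inv_smul, mvNormalPDF_inv_smul, nonsing_inv_nonsing_inv _ hunit,
    nonsing_inv_nonsing_inv P' (hdet' ▸ (mul_pos hdet hs).ne'.isUnit),
    normalPDF_eq (inv_pos.mpr hτ), normalPDF_eq (by positivity), mul_mul_mul_comm, ← mul_inv,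
    hconst, mul_inv, ← Real.exp_add, mul_mul_mul_comm _ _ _ (Real.exp _), ← Real.exp_add]
  congr 2
  rw [div_mul_eq_div_div, div_mul_eq_div_div, div_mul_eq_div_div, div_inv_eq_mul, div_inv_eq_mul]
  linear_combination (-(1 / 2) * τ) * hsquare

end MultivariateNormal

section Gamma

variable {a r : ℝ}

theorem gammaPDFReal_of_neg {t : ℝ} (ht : t < 0) : gammaPDFReal a r t = 0 :=
  if_neg ht.not_ge

theorem gammaPDFReal_of_pos {t : ℝ} (ht : 0 < t) :
    gammaPDFReal a r t = r ^ a / Real.Gamma a * t ^ (a - 1) * Real.exp (-(r * t)) :=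
  if_pos ht.le

theorem isProbDensity_gammaPDFReal (ha : 0 < a) (hr : 0 < r) :
    IsProbDensity (gammaPDFReal a r) := by
  refine .of_integral_eq_one (gammaPDFReal_nonneg ha hr) ?_
  rw [integral_eq_lintegral_of_nonneg_ae (.of_forall (gammaPDFReal_nonneg ha hr))
    (measurable_gammaPDFReal a r).aestronglyMeasurable]
  exact (congrArg ENNReal.toReal (lintegral_gammaPDF_eq_one ha hr)).trans ENNReal.toReal_one

theorem integrable_gammaPDFReal_mul_rpow {s : ℝ} (hr : 0 < r) (has : 0 < a + s) :
    Integrable fun t => gammaPDFReal a r t * t ^ s := by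
  refine ((isProbDensity_gammaPDFReal has hr).integrable.const_mul
    (r ^ a / Real.Gamma a * (Real.Gamma (a + s) / r ^ (a + s)))).congr ?_
  filter_upwards [Measure.ae_ne volume (0 : ℝ)] with t ht
  rcases ht.lt_or_gt with ht | ht
  · rw [gammaPDFReal_of_neg ht, gammaPDFReal_of_neg ht, mul_zero, zero_mul]
  · have hΓ : Real.Gamma (a + s) ≠ 0 := (Real.Gamma_pos_of_pos has).ne'
    have hpow : t ^ (a + s - 1) = t ^ (a - 1) * t ^ s := by
      rw [← Real.rpow_add ht]
      ring_nf
    rw [gammaPDFReal_of_pos ht, gammaPDFReal_of_pos ht, hpow]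
    field_simp

theorem abs_log_le_rpow_add_rpow_div {t ε : ℝ} (ht : 0 < t) (hε : 0 < ε) :
    |Real.log t| ≤ (t ^ ε + t ^ (-ε)) / ε := by
  have hlog := Real.log_le_rpow_div ht.le hε
  have hlog_inv := Real.log_le_rpow_div (inv_nonneg.mpr ht.le) hε
  rw [Real.log_inv, Real.inv_rpow ht.le, ← Real.rpow_neg ht.le] at hlog_inv
  have hpos : 0 ≤ t ^ ε / ε := by positivity
  have hpos_inv : 0 ≤ t ^ (-ε) / ε := by positivity
  rw [add_div]
  exact abs_le.mpr ⟨by linarith, by linarith⟩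

theorem integrable_gammaPDFReal_mul_log (ha : 0 < a) (hr : 0 < r) :
    Integrable fun t => gammaPDFReal a r t * Real.log t := by
  have hdom := ((integrable_gammaPDFReal_mul_rpow hr (by linarith : 0 < a + a / 2)).add
    (integrable_gammaPDFReal_mul_rpow hr (by linarith : 0 < a + -(a / 2)))).div_const (a / 2)
  refine hdom.mono' (by fun_prop) ?_
  filter_upwards [Measure.ae_ne volume (0 : ℝ)] with t ht
  rcases ht.lt_or_gt with ht | ht
  · simp only [gammaPDFReal_of_neg ht, zero_mul, norm_zero, Pi.add_apply, add_zero, zero_div,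
      le_refl]
  · rw [norm_mul, Real.norm_of_nonneg (gammaPDFReal_nonneg ha hr t), Pi.add_apply, ← mul_add,
      mul_div_assoc]
    exact mul_le_mul_of_nonneg_left (abs_log_le_rpow_add_rpow_div ht (half_pos ha))
      (gammaPDFReal_nonneg ha hr t)

end Gamma

section Student

/-- The density of `ε / √τ` for a standard normal `ε` and an independent gamma variable `τ` with
shape `a` and rate `r`, that is, of `√(r / a)` times a Student variable with `2 * a` degrees of
freedom. -/
def studentPDF (a r x : ℝ) : ℝ :=
  r ^ a * Real.Gamma (a + 1 / 2) / (√(2 * Real.pi) * Real.Gamma a) *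
    (r + x ^ 2 / 2) ^ (-(a + 1 / 2))

variable {a r : ℝ}

theorem studentPDF_pos (ha : 0 < a) (hr : 0 < r) (x : ℝ) : 0 < studentPDF a r x := by
  unfold studentPDF
  positivity

theorem measurable_studentPDF (a r : ℝ) : Measurable (studentPDF a r) := by
  unfold studentPDF
  fun_prop

theorem normalPDF_mul_gammaPDFReal (ha : 0 < a) (hr : 0 < r) (x : ℝ) {t : ℝ} (ht : t ≠ 0) :
    normalPDF 0 t⁻¹ x * gammaPDFReal a r t =
      studentPDF a r x * gammaPDFReal (a + 1 / 2) (r + x ^ 2 / 2) t := by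
  rcases ht.lt_or_gt with ht | ht
  · rw [gammaPDFReal_of_neg ht, gammaPDFReal_of_neg ht, mul_zero, mul_zero]
  have hR : 0 < r + x ^ 2 / 2 := by positivity
  have hpow : t ^ (a + 1 / 2 - 1) = t ^ (a - 1) * √t := by
    rw [Real.sqrt_eq_rpow, ← Real.rpow_add ht]
    ring_nf
  have hexp : Real.exp (-((r + x ^ 2 / 2) * t)) =
      Real.exp (-(x - 0) ^ 2 / (2 * t⁻¹)) * Real.exp (-(r * t)) := by
    rw [← Real.exp_add]
    congr 1
    field_simp
    ring
  have hsqrt : (√(2 * Real.pi * t⁻¹))⁻¹ = (√(2 * Real.pi))⁻¹ * √t := by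
    rw [Real.sqrt_mul (by positivity), Real.sqrt_inv, mul_inv, inv_inv]
  rw [normalPDF_eq (inv_pos.mpr ht), gammaPDFReal_of_pos ht, gammaPDFReal_of_pos ht, studentPDF,
    hpow, hexp, hsqrt, Real.rpow_neg hR.le]
  field_simp

theorem isProbDensity_studentPDF (ha : 0 < a) (hr : 0 < r) : IsProbDensity (studentPDF a r) := by
  have hmixture : HasIntegral
      (fun z : ℝ × ℝ => gammaPDFReal a r z.2 * normalPDF 0 z.2⁻¹ z.1) 1 := by
    refine (isProbDensity_gammaPDFReal ha hr).hasIntegral.mul_condDensity_swap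
      (K := fun t => normalPDF 0 t⁻¹) ?_ ?_
    · exact (((measurable_gammaPDFReal a r).comp measurable_snd).mul (measurable_normalPDF
        measurable_const measurable_snd.inv measurable_fst)).aestronglyMeasurable
    · filter_upwards [Measure.ae_ne volume (0 : ℝ)] with t ht h0
      exact isProbDensity_normalPDF
        (inv_pos.mpr (ht.symm.lt_of_le (not_lt.mp (mt gammaPDFReal_of_neg h0)))) 0
  have hsection (x : ℝ) : ∫ t, gammaPDFReal a r t * normalPDF 0 t⁻¹ x = studentPDF a r x := by
    have hpost := ((isProbDensity_gammaPDFReal (by linarith : 0 < a + 1 / 2)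
      (by positivity : 0 < r + x ^ 2 / 2)).hasIntegral.const_mul (studentPDF a r x)).integral_eq
    rw [mul_one] at hpost
    rw [← hpost]
    refine integral_congr_ae ?_
    filter_upwards [Measure.ae_ne volume (0 : ℝ)] with t ht
    rw [← normalPDF_mul_gammaPDFReal ha hr x ht, mul_comm]
  refine .of_integral_eq_one (fun x => (studentPDF_pos ha hr x).le) ?_
  simp only [← hsection]
  rw [← hmixture.integral_eq]
  exact (integral_prod _ hmixture.integrable).symm

theorem rpow_mul_studentPDF {s : ℝ} (hs : s < a) (hr : 0 < r) (x : ℝ) :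
    (r + x ^ 2 / 2) ^ s * studentPDF a r x =
      r ^ s * (Real.Gamma (a + 1 / 2) / Real.Gamma a) *
        (Real.Gamma (a - s) / Real.Gamma (a - s + 1 / 2)) * studentPDF (a - s) r x := by
  have hΓ : 0 < Real.Gamma (a - s) := Real.Gamma_pos_of_pos (by linarith)
  have hΓ' : 0 < Real.Gamma (a - s + 1 / 2) := Real.Gamma_pos_of_pos (by linarith)
  have hpow : (r + x ^ 2 / 2) ^ (-(a - s + 1 / 2)) =
      (r + x ^ 2 / 2) ^ s * (r + x ^ 2 / 2) ^ (-(a + 1 / 2)) := by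
    rw [← Real.rpow_add (by positivity)]
    ring_nf
  have hrate : r ^ a = r ^ s * r ^ (a - s) := by rw [← Real.rpow_add hr, add_sub_cancel]
  rw [studentPDF, studentPDF, hpow, hrate]
  generalize Real.Gamma (a - s + 1 / 2) = G at hΓ' ⊢
  field_simp

theorem hasIntegral_studentPDF_mul_sq (ha : 1 < a) (hr : 0 < r) :
    HasIntegral (fun x => studentPDF a r x * x ^ 2) (r / (a - 1)) := by
  have hΓ : Real.Gamma a = (a - 1) * Real.Gamma (a - 1) := by
    rw [← Real.Gamma_add_one (by linarith), sub_add_cancel]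
  have hΓ' : Real.Gamma (a + 1 / 2) = (a - 1 / 2) * Real.Gamma (a - 1 + 1 / 2) := by
    rw [show a - 1 + 1 / 2 = a - 1 / 2 by ring, ← Real.Gamma_add_one (by linarith)]
    ring_nf
  have hΓ_pos : 0 < Real.Gamma (a - 1) := Real.Gamma_pos_of_pos (by linarith)
  have hΓ'_pos : 0 < Real.Gamma (a - 1 + 1 / 2) := Real.Gamma_pos_of_pos (by linarith)
  have ha' : a - 1 ≠ 0 := by linarith
  have hshift (x : ℝ) : (r + x ^ 2 / 2) * studentPDF a r x =
      r * ((a - 1 / 2) / (a - 1)) * studentPDF (a - 1) r x := by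
    have h := rpow_mul_studentPDF ha hr x
    rw [Real.rpow_one, Real.rpow_one, hΓ, hΓ'] at h
    rw [h]
    generalize Real.Gamma (a - 1 + 1 / 2) = G at hΓ'_pos
    field_simp
  have h := ((isProbDensity_studentPDF (by linarith : 0 < a - 1) hr).hasIntegral.const_mul
    (2 * (r * ((a - 1 / 2) / (a - 1))))).sub
      ((isProbDensity_studentPDF (by linarith : 0 < a) hr).hasIntegral.const_mul (2 * r))
  rw [show 2 * (r * ((a - 1 / 2) / (a - 1))) * 1 - 2 * r * 1 = r / (a - 1) by field_simp; ring] at h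
  refine h.congr (.of_forall fun x => ?_)
  linear_combination (-2) * hshift x

theorem hasIntegral_studentPDF_mul_id (ha : 1 < a) (hr : 0 < r) :
    HasIntegral (fun x => studentPDF a r x * x) 0 := by
  constructor
  · refine ((isProbDensity_studentPDF (by linarith : 0 < a) hr).integrable.add
      (hasIntegral_studentPDF_mul_sq ha hr).integrable).mono'
      ((measurable_studentPDF a r).mul measurable_id).aestronglyMeasurable (.of_forall fun x => ?_)
    have hpos := (studentPDF_pos (by linarith : 0 < a) hr x).le
    rw [norm_mul, Real.norm_of_nonneg hpos, Pi.add_apply, ← mul_one_add]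
    exact mul_le_mul_of_nonneg_left
      (abs_le.mpr ⟨by nlinarith [sq_nonneg (x + 1)], by nlinarith [sq_nonneg (x - 1)]⟩) hpos
  · have hodd (x : ℝ) : studentPDF a r (-x) * -x = -(studentPDF a r x * x) := by
      rw [studentPDF, studentPDF, neg_sq, mul_neg]
    have h := integral_neg_eq_self (fun x => studentPDF a r x * x) volume
    simp only [hodd, integral_neg] at h
    linarith

theorem log_studentPDF (ha : 0 < a) (hr : 0 < r) (x : ℝ) :
    Real.log (studentPDF a r x) =
      Real.log (r ^ a * Real.Gamma (a + 1 / 2) / (√(2 * Real.pi) * Real.Gamma a)) -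
        (a + 1 / 2) * Real.log (r + x ^ 2 / 2) := by
  rw [studentPDF, Real.log_mul (by positivity) (by positivity), Real.log_rpow (by positivity)]
  ring

theorem integrable_negMulLog_studentPDF (ha : 0 < a) (hr : 0 < r) :
    Integrable fun x => Real.negMulLog (studentPDF a r x) := by
  have hpdf := (isProbDensity_studentPDF ha hr).integrable
  have hpow : Integrable fun x => (r + x ^ 2 / 2) ^ (a / 2) * studentPDF a r x := by
    simp only [rpow_mul_studentPDF (half_lt_self ha) hr, sub_half]
    exact (isProbDensity_studentPDF (half_pos ha) hr).integrable.const_mul _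
  have hlog : Integrable fun x => studentPDF a r x * Real.log (r + x ^ 2 / 2) := by
    refine ((hpow.div_const (a / 2)).add (hpdf.const_mul |Real.log r|)).mono'
      ((measurable_studentPDF a r).mul (by fun_prop)).aestronglyMeasurable (.of_forall fun x => ?_)
    have hpos := (studentPDF_pos ha hr x).le
    have hle :
        |Real.log (r + x ^ 2 / 2)| ≤ (r + x ^ 2 / 2) ^ (a / 2) / (a / 2) + |Real.log r| := by
      have hupper := Real.log_le_rpow_div (by positivity : 0 ≤ r + x ^ 2 / 2) (half_pos ha)
      have hlower := Real.log_le_log hr (by linarith [sq_nonneg x] : r ≤ r + x ^ 2 / 2)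
      have hnonneg : 0 ≤ (r + x ^ 2 / 2) ^ (a / 2) / (a / 2) := by positivity
      exact abs_le.mpr
        ⟨by linarith [neg_abs_le (Real.log r)], by linarith [abs_nonneg (Real.log r)]⟩
    rw [norm_mul, Real.norm_of_nonneg hpos, Pi.add_apply]
    refine (mul_le_mul_of_nonneg_left hle hpos).trans_eq ?_
    ring
  refine ((hlog.const_mul (a + 1 / 2)).sub (hpdf.const_mul
    (Real.log (r ^ a * Real.Gamma (a + 1 / 2) / (√(2 * Real.pi) * Real.Gamma a))))).congr
      (.of_forall fun x => ?_)
  simp only [Real.negMulLog, log_studentPDF ha hr, Pi.sub_apply]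
  ring

end Student

theorem ae_snd_ne_zero {X : Type*} [MeasureSpace X] : ∀ᵐ w : X × ℝ, w.2 ≠ 0 :=
  Measure.quasiMeasurePreserving_snd.ae (Measure.ae_ne volume 0)

namespace NGParam

variable {D : ℕ} {q : NGParam D} {c h : ℝ → ℝ} {I : ℝ}

/-- The conditions under which `q.pdf` is the density of a normal-gamma distribution. -/
structure Valid (q : NGParam D) : Prop where
  posDef : q.Λ.PosDef
  shape_pos : 0 < q.α
  rate_pos : 0 < q.β

/-- The factor `φᵀ Λ⁻¹ φ + 1` by which uncertainty about `θ` inflates the noise variance in the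
prediction of the output for the regressor `φ`. -/
def scaleSq (q : NGParam D) (f : Fin D → ℝ) : ℝ := f ⬝ᵥ (q.Λ⁻¹ *ᵥ f) + 1

/-- The joint density of the output and the parameters, as a function of `(y, θ, τ)`, for the
regressor `f` when the parameters have density `q.pdf`. -/
def joint (q : NGParam D) (f : Fin D → ℝ) (z : ℝ × (Fin D → ℝ) × ℝ) : ℝ :=
  normalPDF (z.2.1 ⬝ᵥ f) z.2.2⁻¹ z.1 * q.pdf z.2.1 z.2.2

/-- The posterior predictive density of the output for the regressor `f`: a Student distribution
with location `μᵀ f` and squared scale `q.scaleSq f`, the factor `β / α` of the usual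
parametrization being part of `studentPDF`. -/
def predictive (q : NGParam D) (f : Fin D → ℝ) : ℝ → ℝ :=
  locScale (studentPDF q.α q.β) (q.μ ⬝ᵥ f) √(q.scaleSq f)

/-- The conditional differential entropy of the output given `(θ, τ)`, which is the entropy of
the observation noise averaged over the precision `τ`. -/
def noiseEntropy (q : NGParam D) : ℝ :=
  ∫ τ, gammaPDFReal q.α q.β τ * diffEntropy (normalPDF 0 τ⁻¹)

theorem pdf_of_neg (θ : Fin D → ℝ) {τ : ℝ} (hτ : τ < 0) : q.pdf θ τ = 0 := by
  rw [pdf, gammaPDFReal_of_neg hτ, mul_zero]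

theorem measurable_pdf (q : NGParam D) :
    Measurable fun w : (Fin D → ℝ) × ℝ => q.pdf w.1 w.2 :=
  (measurable_mvNormalPDF_inv_smul q.μ q.Λ).mul ((measurable_gammaPDFReal _ _).comp measurable_snd)

theorem measurable_joint (q : NGParam D) (f : Fin D → ℝ) : Measurable (q.joint f) :=
  (measurable_normalPDF (by fun_prop) (by fun_prop) (by fun_prop)).mul
    (q.measurable_pdf.comp measurable_snd)

theorem Valid.scaleSq_pos (hq : q.Valid) (f : Fin D → ℝ) : 0 < q.scaleSq f :=
  quadForm_inv_add_one_pos hq.posDef f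

theorem Valid.predictive_pos (hq : q.Valid) (f : Fin D → ℝ) (y : ℝ) : 0 < q.predictive f y :=
  mul_pos (inv_pos.mpr (Real.sqrt_pos.mpr (hq.scaleSq_pos f)))
    (studentPDF_pos hq.shape_pos hq.rate_pos _)

theorem Valid.isProbDensity_predictive (hq : q.Valid) (f : Fin D → ℝ) :
    IsProbDensity (q.predictive f) :=
  (isProbDensity_studentPDF hq.shape_pos hq.rate_pos).locScale _
    (Real.sqrt_pos.mpr (hq.scaleSq_pos f))

theorem Valid.update_rate (hq : q.Valid) (f : Fin D → ℝ) (y : ℝ) :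
    (q.update f y).β = q.β + (y - q.μ ⬝ᵥ f) ^ 2 / q.scaleSq f / 2 := by
  have hsquare := sq_sub_add_quadForm_eq (isHermitian_iff_isSymm.mp hq.posDef.isHermitian)
    hq.posDef.det_pos.ne'.isUnit (hq.scaleSq_pos f).ne' q.μ 0 y
  simp only [zero_dotProduct, sub_zero, zero_sub, mulVec_neg, dotProduct_neg, neg_dotProduct,
    neg_neg] at hsquare
  simp only [update, scaleSq]
  linear_combination (1 / 2) * hsquare

theorem Valid.update (hq : q.Valid) (f : Fin D → ℝ) (y : ℝ) : (q.update f y).Valid where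
  posDef := .posSemidef_add (by simpa using posSemidef_vecMulVec_self_star f) hq.posDef
  shape_pos := add_pos hq.shape_pos one_half_pos
  rate_pos := by
    have := hq.rate_pos
    have := hq.scaleSq_pos f
    rw [hq.update_rate]
    positivity

theorem Valid.hasIntegral_pdf_mul (hq : q.Valid)
    (hc : HasIntegral (fun τ => gammaPDFReal q.α q.β τ * c τ) I) :
    HasIntegral (fun w : (Fin D → ℝ) × ℝ => q.pdf w.1 w.2 * c w.2) I := by
  refine (hc.mul_condDensity_swap (K := fun τ => mvNormalPDF q.μ (τ • q.Λ)⁻¹) ?_ ?_).congr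
    (.of_forall fun w => by simp only [pdf]; ring)
  · exact hc.integrable.aestronglyMeasurable.comp_snd.mul
      (measurable_mvNormalPDF_inv_smul q.μ q.Λ).aestronglyMeasurable
  · filter_upwards [Measure.ae_ne volume 0] with τ hτ hγ
    have hτ_pos : 0 < τ := hτ.lt_or_gt.resolve_left fun hneg => hγ <| by
      rw [gammaPDFReal_of_neg hneg, zero_mul]
    exact isProbDensity_mvNormalPDF (hq.posDef.smul hτ_pos).inv q.μ

theorem Valid.isProbDensity_pdf (hq : q.Valid) :
    IsProbDensity fun w : (Fin D → ℝ) × ℝ => q.pdf w.1 w.2 where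
  nonneg w := mul_nonneg (mvNormalPDF_nonneg _ _ _)
    (gammaPDFReal_nonneg hq.shape_pos hq.rate_pos w.2)
  hasIntegral := by
    have hγ := (isProbDensity_gammaPDFReal hq.shape_pos hq.rate_pos).hasIntegral
    simpa only [mul_one] using hq.hasIntegral_pdf_mul (c := fun _ => 1) (by simpa only [mul_one])

theorem Valid.normalPDF_mul_pdf (hq : q.Valid) (f θ : Fin D → ℝ) {τ : ℝ} (hτ : τ ≠ 0) (y : ℝ) :
    normalPDF (θ ⬝ᵥ f) τ⁻¹ y * q.pdf θ τ = q.predictive f y * (q.update f y).pdf θ τ := by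
  rcases hτ.lt_or_gt with hneg | hpos
  · rw [pdf_of_neg θ hneg, pdf_of_neg θ hneg, mul_zero, mul_zero]
  have hs := hq.scaleSq_pos f
  have hmarginal : normalPDF (q.μ ⬝ᵥ f) (q.scaleSq f * τ⁻¹) y * gammaPDFReal q.α q.β τ =
      q.predictive f y * gammaPDFReal (q.update f y).α (q.update f y).β τ := by
    have hstudent := normalPDF_mul_gammaPDFReal hq.shape_pos hq.rate_pos
      ((y - q.μ ⬝ᵥ f) / √(q.scaleSq f)) hτ
    have hscale := normalPDF_sq_mul (Real.sqrt_pos.mpr hs) (inv_pos.mpr hpos) (q.μ ⬝ᵥ f)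
    rw [div_pow, Real.sq_sqrt hs.le, ← hq.update_rate] at hstudent
    rw [Real.sq_sqrt hs.le] at hscale
    rw [hscale, predictive, locScale, locScale, mul_assoc, hstudent, mul_assoc]
    rfl
  rw [pdf, ← mul_assoc, normalPDF_mul_mvNormalPDF hq.posDef hpos, mul_right_comm]
  change normalPDF (q.μ ⬝ᵥ f) (q.scaleSq f * τ⁻¹) y * _ * _ = _
  rw [hmarginal, pdf, mul_assoc, mul_comm (gammaPDFReal _ _ τ)]
  rfl

theorem Valid.hasIntegral_joint (hq : q.Valid) (f : Fin D → ℝ) (y : ℝ) :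
    HasIntegral (fun w => q.joint f (y, w)) (q.predictive f y) := by
  have hpost := (hq.update f y).isProbDensity_pdf.hasIntegral.const_mul (q.predictive f y)
  rw [mul_one] at hpost
  refine hpost.congr ?_
  filter_upwards [ae_snd_ne_zero] with w hw using (hq.normalPDF_mul_pdf f w.1 hw y).symm

theorem Valid.hasIntegral_joint_mul_output (hq : q.Valid) (f : Fin D → ℝ)
    (hh : HasIntegral (fun y => q.predictive f y * h y) I) :
    HasIntegral (fun z : ℝ × (Fin D → ℝ) × ℝ => q.joint f z * h z.1) I := by
  have hconj : (fun z : ℝ × (Fin D → ℝ) × ℝ =>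
      q.predictive f z.1 * h z.1 * (q.update f z.1).pdf z.2.1 z.2.2) =ᵐ[volume]
        fun z => q.joint f z * h z.1 := by
    filter_upwards [Measure.quasiMeasurePreserving_snd.ae ae_snd_ne_zero] with z hz
    rw [joint, hq.normalPDF_mul_pdf f z.2.1 hz, mul_right_comm]
  have hh_meas : AEMeasurable h :=
    (hh.integrable.aemeasurable.div (hq.isProbDensity_predictive f).integrable.aemeasurable).congr
      (.of_forall fun y => mul_div_cancel_left₀ _ (hq.predictive_pos f y).ne')
  have hmixture_meas : AEStronglyMeasurable (fun z : ℝ × (Fin D → ℝ) × ℝ =>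
      q.predictive f z.1 * h z.1 * (q.update f z.1).pdf z.2.1 z.2.2) (volume.prod volume) :=
    (((q.measurable_joint f).aemeasurable.mul hh_meas.comp_fst).congr
      hconj.symm).aestronglyMeasurable
  have hmixture := hh.mul_condDensity
    (K := fun y (w : (Fin D → ℝ) × ℝ) => (q.update f y).pdf w.1 w.2) hmixture_meas
    (.of_forall fun y _ => (hq.update f y).isProbDensity_pdf)
  exact hmixture.congr hconj

theorem Valid.hasIntegral_pdf_mul_condDensity (hq : q.Valid)
    (hc : HasIntegral (fun τ => gammaPDFReal q.α q.β τ * c τ) I)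
    {K : (Fin D → ℝ) → ℝ → ℝ → ℝ}
    (hmeas : Measurable fun z : ℝ × (Fin D → ℝ) × ℝ => K z.2.1 z.2.2 z.1)
    (hK : ∀ θ, ∀ τ > 0, IsProbDensity (K θ τ)) :
    HasIntegral (fun z : ℝ × (Fin D → ℝ) × ℝ => q.pdf z.2.1 z.2.2 * c z.2.2 * K z.2.1 z.2.2 z.1)
      I := by
  have hpdf := hq.hasIntegral_pdf_mul hc
  refine hpdf.mul_condDensity_swap (μ := volume) (K := fun w => K w.1 w.2)
    (hpdf.integrable.aestronglyMeasurable.comp_snd.mul hmeas.aestronglyMeasurable) ?_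
  filter_upwards [ae_snd_ne_zero] with w hw hne
  exact hK _ _ <| hw.lt_or_gt.resolve_left fun hneg => hne <| by
    rw [pdf_of_neg w.1 hneg, zero_mul]

theorem Valid.hasIntegral_gammaPDFReal_mul_noiseEntropy (hq : q.Valid) :
    HasIntegral (fun τ => gammaPDFReal q.α q.β τ * diffEntropy (normalPDF 0 τ⁻¹))
      q.noiseEntropy := by
  refine ⟨?_, rfl⟩
  refine (((isProbDensity_gammaPDFReal hq.shape_pos hq.rate_pos).integrable.const_mul
    (1 / 2 * Real.log (2 * Real.pi) + 1 / 2)).sub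
      ((integrable_gammaPDFReal_mul_log hq.shape_pos hq.rate_pos).const_mul (1 / 2))).congr ?_
  filter_upwards [Measure.ae_ne volume 0] with τ hτ
  rcases hτ.lt_or_gt with hneg | hpos
  · simp only [Pi.sub_apply, gammaPDFReal_of_neg hneg, zero_mul, mul_zero, sub_zero]
  · simp only [Pi.sub_apply]
    rw [diffEntropy_normalPDF (inv_pos.mpr hpos), Real.log_mul (x := 2 * Real.pi)
      (by positivity) (by positivity), Real.log_inv]
    ring

theorem Valid.hasIntegral_joint_mul_neg_log_likelihood (hq : q.Valid) (f : Fin D → ℝ) :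
    HasIntegral (fun z : ℝ × (Fin D → ℝ) × ℝ =>
      q.joint f z * -Real.log (normalPDF (z.2.1 ⬝ᵥ f) z.2.2⁻¹ z.1)) q.noiseEntropy := by
  have hhalf := (isProbDensity_gammaPDFReal hq.shape_pos hq.rate_pos).hasIntegral.const_mul (1 / 2)
  have hnormal : Measurable fun z : ℝ × (Fin D → ℝ) × ℝ =>
      normalPDF (z.2.1 ⬝ᵥ f) z.2.2⁻¹ z.1 :=
    measurable_normalPDF (by fun_prop) (by fun_prop) (by fun_prop)
  have hlogNormalizer := hq.hasIntegral_pdf_mul_condDensity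
    (c := fun τ => diffEntropy (normalPDF 0 τ⁻¹) - 1 / 2)
    ((hq.hasIntegral_gammaPDFReal_mul_noiseEntropy.sub hhalf).congr
      (.of_forall fun τ => by ring)) hnormal
    fun θ τ hτ => isProbDensity_normalPDF (inv_pos.mpr hτ) (θ ⬝ᵥ f)
  have hsquare := hq.hasIntegral_pdf_mul_condDensity (c := fun _ => 1 / 2)
    (hhalf.congr (.of_forall fun τ => mul_comm _ _))
    (K := fun θ τ y => normalPDF (θ ⬝ᵥ f) τ⁻¹ y * ((y - θ ⬝ᵥ f) ^ 2 / τ⁻¹))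
    (hnormal.mul (by fun_prop))
    fun θ τ hτ => isProbDensity_normalPDF_mul_sq (inv_pos.mpr hτ) (θ ⬝ᵥ f)
  have hsum := hlogNormalizer.add hsquare
  rw [mul_one, sub_add_cancel] at hsum
  refine hsum.congr ?_
  filter_upwards [Measure.quasiMeasurePreserving_snd.ae ae_snd_ne_zero] with z hz
  rcases hz.lt_or_gt with hneg | hpos
  · simp only [joint, pdf_of_neg z.2.1 hneg, zero_mul, mul_zero, add_zero]
  · rw [joint, log_normalPDF (inv_pos.mpr hpos), diffEntropy_normalPDF (inv_pos.mpr hpos)]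
    ring

theorem Valid.hasIntegral_predictive_mul_neg_log (hq : q.Valid) (f : Fin D → ℝ) :
    HasIntegral (fun y => q.predictive f y * -Real.log (q.predictive f y))
      (diffEntropy (studentPDF q.α q.β) + 1 / 2 * Real.log (q.scaleSq f)) := by
  have hent := (isProbDensity_studentPDF hq.shape_pos hq.rate_pos).hasIntegral_negMulLog_locScale
    (integrable_negMulLog_studentPDF hq.shape_pos hq.rate_pos) (q.μ ⬝ᵥ f)
    (Real.sqrt_pos.mpr (hq.scaleSq_pos f))
  rw [Real.log_sqrt (hq.scaleSq_pos f).le, div_eq_inv_mul, ← one_div] at hent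
  exact hent.congr (.of_forall fun y => neg_mul_comm _ _)

theorem Valid.hasIntegral_predictive_mul_neg_log_normalPDF (hq : q.Valid) (hshape : 1 < q.α)
    (f : Fin D → ℝ) (m : ℝ) {v : ℝ} (hv : 0 < v) :
    HasIntegral (fun y => q.predictive f y * -Real.log (normalPDF m v y))
      (1 / 2 * Real.log (2 * Real.pi * v) +
        1 / (2 * v) * ((q.μ ⬝ᵥ f - m) ^ 2 + q.scaleSq f * (q.β / (q.α - 1)))) := by
  have hs := hq.scaleSq_pos f
  have hsquare := (isProbDensity_studentPDF hq.shape_pos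
    hq.rate_pos).hasIntegral_locScale_mul_sq_sub (hasIntegral_studentPDF_mul_id hshape hq.rate_pos)
      (hasIntegral_studentPDF_mul_sq hshape hq.rate_pos) (q.μ ⬝ᵥ f) m (Real.sqrt_pos.mpr hs)
  rw [Real.sq_sqrt hs.le] at hsquare
  have hsum := ((hq.isProbDensity_predictive f).hasIntegral.const_mul
    (1 / 2 * Real.log (2 * Real.pi * v))).add (hsquare.const_mul (1 / (2 * v)))
  rw [mul_one] at hsum
  refine hsum.congr (.of_forall fun y => ?_)
  simp only [log_normalPDF hv, predictive]
  ring

end NGParam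

section LogRatio

variable {l e p n : ℝ}

theorem mul_log_div_mul_eq (hp : p ≠ 0) :
    l * e * Real.log (l * e / (e * p)) = l * e * -Real.log p - l * e * -Real.log l := by
  rcases eq_or_ne e 0 with rfl | he
  · ring
  rcases eq_or_ne l 0 with rfl | hl
  · ring
  rw [mul_comm e p, mul_div_mul_right _ _ he, Real.log_div hl hp]
  ring

theorem mul_log_div_div_mul_eq (hp : p ≠ 0) (hn : n ≠ 0) :
    l * e * Real.log (e / (l * e / p * n)) =
      l * e * -Real.log n - l * e * Real.log (l * e / (e * p)) := by
  rcases eq_or_ne e 0 with rfl | he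
  · ring
  rcases eq_or_ne l 0 with rfl | hl
  · ring
  rw [show e / (l * e / p * n) = (l * e / (e * p))⁻¹ * n⁻¹ by field_simp,
    Real.log_mul (by positivity) (by positivity), Real.log_inv, Real.log_inv]
  ring

end LogRatio

namespace Agent

variable {My Mu D : ℕ} {A : Agent My Mu D}

theorem param_valid (hA : A.prior.Valid) (k : ℕ) : (A.param k).Valid := by
  induction k with
  | zero => exact hA
  | succ k ih => exact ih.update _ _

theorem predictive_eq_of_posterior_eq {k : ℕ} (hq : (A.param k).Valid)
    (hpost : ∀ θ τ, τ ≠ 0 → A.posterior k θ τ = (A.param k).pdf θ τ) (u y : ℝ) :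
    A.predictive k u y = (A.param k).predictive (A.feature (k + 1) u) y := by
  rw [← (hq.hasIntegral_joint _ y).integral_eq]
  refine integral_congr_ae ?_
  filter_upwards [ae_snd_ne_zero] with w hw
  rw [joint, likelihood, hpost w.1 w.2 hw, NGParam.joint]

theorem posterior_eq (hA : A.prior.Valid) (k : ℕ) (θ : Fin D → ℝ) {τ : ℝ} (hτ : τ ≠ 0) :
    A.posterior k θ τ = (A.param k).pdf θ τ := by
  induction k generalizing θ τ with
  | zero => rfl
  | succ k ih =>
    have hq := param_valid hA k
    change A.likelihood (k + 1) (A.uObs (k + 1)) (A.yObs (k + 1)) θ τ * A.posterior k θ τ /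
      A.predictive k (A.uObs (k + 1)) (A.yObs (k + 1)) = _
    rw [predictive_eq_of_posterior_eq hq fun θ τ hτ => ih θ hτ, ih θ hτ, likelihood,
      hq.normalPDF_mul_pdf _ θ hτ, mul_div_cancel_left₀ _ (hq.predictive_pos _ _).ne', param]

theorem predictive_eq (hA : A.prior.Valid) (k : ℕ) (u y : ℝ) :
    A.predictive k u y = (A.param k).predictive (A.feature (k + 1) u) y :=
  predictive_eq_of_posterior_eq (param_valid hA k) (fun θ _ hτ => posterior_eq hA k θ hτ) u y

theorem joint_eq (hA : A.prior.Valid) (k : ℕ) (u y : ℝ) (θ : Fin D → ℝ) {τ : ℝ} (hτ : τ ≠ 0) :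
    A.joint k u y θ τ = (A.param k).joint (A.feature (k + 1) u) (y, θ, τ) := by
  rw [joint, likelihood, posterior_eq hA k θ hτ, NGParam.joint]

theorem hasIntegral_mutualInfoIntegrand (hA : A.prior.Valid) (k : ℕ) (u : ℝ) :
    HasIntegral (A.mutualInfoIntegrand k u)
      (diffEntropy (studentPDF (A.param k).α (A.param k).β) +
        1 / 2 * Real.log ((A.param k).scaleSq (A.feature (k + 1) u)) -
          (A.param k).noiseEntropy) := by
  have hq := param_valid hA k
  refine ((hq.hasIntegral_joint_mul_output _ (hq.hasIntegral_predictive_mul_neg_log _)).sub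
    (hq.hasIntegral_joint_mul_neg_log_likelihood (A.feature (k + 1) u))).congr ?_
  filter_upwards [Measure.quasiMeasurePreserving_snd.ae ae_snd_ne_zero] with z hz
  rw [mutualInfoIntegrand, joint_eq hA k u _ _ hz, posterior_eq hA k _ hz, predictive_eq hA]
  exact (mul_log_div_mul_eq (hq.predictive_pos _ _).ne').symm

theorem hasIntegral_crossEntropyIntegrand (hA : A.prior.Valid) {k : ℕ}
    (hk : 1 < (A.param k).α) (m : ℝ) {v : ℝ} (hv : 0 < v) (u : ℝ) :
    HasIntegral (A.crossEntropyIntegrand k m v u)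
      (1 / 2 * Real.log (2 * Real.pi * v) +
        1 / (2 * v) * (((A.param k).μ ⬝ᵥ A.feature (k + 1) u - m) ^ 2 +
          (A.param k).scaleSq (A.feature (k + 1) u) *
            ((A.param k).β / ((A.param k).α - 1)))) :=
  ((param_valid hA k).hasIntegral_predictive_mul_neg_log_normalPDF hk _ m hv).congr
    (.of_forall fun y => by rw [crossEntropyIntegrand, predictive_eq hA])

theorem hasIntegral_efeIntegrand (hA : A.prior.Valid) {k : ℕ} {m v u I J : ℝ} (hv : 0 < v)
    (hCE : HasIntegral (A.crossEntropyIntegrand k m v u) I)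
    (hMI : HasIntegral (A.mutualInfoIntegrand k u) J) :
    HasIntegral (A.efeIntegrand k m v u) (I - J) := by
  have hq := param_valid hA k
  have hgoal := hq.hasIntegral_joint_mul_output (A.feature (k + 1) u)
    (hCE.congr (.of_forall fun y => by rw [crossEntropyIntegrand, predictive_eq hA]))
  refine (hgoal.sub hMI).congr ?_
  filter_upwards [Measure.quasiMeasurePreserving_snd.ae ae_snd_ne_zero] with z hz
  have hgoal_pos : 0 < normalPDF m v z.1 := gaussianPDFReal_pos _ _ _ (Real.toNNReal_pos.mpr hv).ne'
  rw [← joint_eq hA k u _ _ hz]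
  refine (mul_log_div_div_mul_eq ?_ hgoal_pos.ne').symm
  rw [predictive_eq hA]
  exact (hq.predictive_pos _ _).ne'

end Agent

end NARX

end

theorem mainTheorem3 {My Mu D : ℕ} (A : NARX.Agent My Mu D)
    (hΛ : A.prior.Λ.PosDef) (hα : 0 < A.prior.α) (hβ : 0 < A.prior.β)
    (m v : ℝ) (hv : 0 < v) (k : ℕ) (hk : 1 < (A.param k).α) :
    ∃ C : ℝ, ∀ u : ℝ,
      Integrable (A.efeIntegrand k m v u) ∧
      Integrable (A.crossEntropyIntegrand k m v u) ∧
      Integrable (A.mutualInfoIntegrand k u) ∧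
      A.efe k m v u = A.crossEntropy k m v u - A.mutualInfo k u ∧
      A.efe k m v u =
        1 / (2 * v) *
            (((A.param k).μ ⬝ᵥ A.feature (k + 1) u - m) ^ 2 +
              (A.param k).β / (A.param k).α *
                (A.feature (k + 1) u ⬝ᵥ ((A.param k).Λ⁻¹ *ᵥ A.feature (k + 1) u) + 1) *
                (2 * (A.param k).α / (2 * (A.param k).α - 2))) -
          1 / 2 * Real.log
            (A.feature (k + 1) u ⬝ᵥ ((A.param k).Λ⁻¹ *ᵥ A.feature (k + 1) u) + 1) +
          C := by
  have hA : A.prior.Valid := ⟨hΛ, hα, hβ⟩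
  refine ⟨1 / 2 * Real.log (2 * Real.pi * v) + (A.param k).noiseEntropy -
    NARX.diffEntropy (NARX.studentPDF (A.param k).α (A.param k).β), fun u => ?_⟩
  have hCE := NARX.Agent.hasIntegral_crossEntropyIntegrand hA hk m hv u
  have hMI := NARX.Agent.hasIntegral_mutualInfoIntegrand hA k u
  have hJ := NARX.Agent.hasIntegral_efeIntegrand hA hv hCE hMI
  have hvar : (A.param k).β / ((A.param k).α - 1) =
      (A.param k).β / (A.param k).α * (2 * (A.param k).α / (2 * (A.param k).α - 2)) := by
    have : (A.param k).α ≠ 0 := by positivity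
    have : (A.param k).α - 1 ≠ 0 := (sub_pos.mpr hk).ne'
    field_simp
  refine ⟨hJ.integrable, hCE.integrable, hMI.integrable, ?_, ?_⟩
  · rw [NARX.Agent.efe, NARX.Agent.crossEntropy, NARX.Agent.mutualInfo, hJ.integral_eq,
      hCE.integral_eq, hMI.integral_eq]
  · rw [NARX.Agent.efe, hJ.integral_eq, hvar, NARX.NGParam.scaleSq]
    ring
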